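/- Let $p(\cdot)\colon\mathbb N\to[1,\infty)$ be a (possibly unbounded) exponent function, with dual exponent $p'(\cdot)\colon\mathbb N\to(1,\infty]$ given by $\frac1{p(k)}+\frac1{p'(k)}=1$ (where $1/\infty=0$). For any exponent $q(\cdot)\colon\mathbb N\to[1,\infty]$ and any real sequence $x$ put $$\rho_{q(\cdot)}(x)=\sum_{q(k)<\infty}|x(k)|^{q(k)}+\sup_{q(k)=\infty}|x(k)|,$$ let $\ell^{q(\cdot)}$ be the space of all real sequences $x$ with $\rho_{q(\cdot)}(x/\lambda)<\infty$ for some $\lambda>0$, normed by $\|x\|_{\ell^{q(\cdot)}}=\inf\{\lambda>0:\rho_{q(\cdot)}(x/\lambda)\le1\}$. Let $\ell^{p(\cdot)}_{b}$ be the subspace of all $x\in\ell^{p(\cdot)}$ with $\sup\{p(k):x(k)\neq0\}<\infty$, and let the germ space be the quotient $\ell^{p(\cdot)}_{\mathrm{germ}}=\ell^{p(\cdot)}/\overline{\ell^{p(\cdot)}_b}$ with the quotient norm. Let $pba(\mathcal B(\mathbb N))$ be the space of purely finitely additive measures on $\mathbb N$, that is, of the finitely additive real-valued set functions $\mu$ on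 all subsets of $\mathbb N$ that have finite total variation $|\mu|(\mathbb N)$ and satisfy $\mu(E)=0$ for every finite $E\subset\mathbb N$, normed by $|\mu|(\mathbb N)$. Theorem 3.4. The condition $$\sum_{k\in\mathbb N}B^{-p(k)}<\infty\quad\text{for some }B>1 \qquad(*)$$ holds if and only if $\ell^{p(\cdot)}$ is isomorphic to $\ell^\infty$ via the identity map, i.e. $\ell^{p(\cdot)}=\ell^\infty$ as sets, with equivalent norms. If $(*)$ holds, then there is an isomorphism of Banach spaces (a linear homeomorphism) $$(\ell^{p(\cdot)})^*\cong\ell^{p'(\cdot)}\oplus pba(\mathcal B(\mathbb N)),$$ where $\oplus$ is the external direct sum. In particular, in this case $(\ell^{p(\cdot)}_{\mathrm{germ}})^*$ is isomorphic to $pba(\mathcal B(\mathbb N))$. -/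

import Mathlib

open scoped ENNReal

noncomputable section

namespace VarSeq

/-- An exponent function on `ℕ` (all subsets measurable): a map `p : ℕ → [1, ∞]`. -/
structure Exponent where
  toFun : ℕ → ℝ≥0∞
  one_le : ∀ k, 1 ≤ toFun k

instance : CoeFun Exponent (fun _ => ℕ → ℝ≥0∞) := ⟨Exponent.toFun⟩

/-- The dual exponent `p'`; see `Exponent.inv_add_inv_dual`. -/
def Exponent.dual (p : Exponent) : Exponent where
  toFun k := ENNReal.conjExponent (p k)
  one_le k := by simp [ENNReal.conjExponent]

theorem Exponent.inv_add_inv_dual (p : Exponent) (k : ℕ) : (p k)⁻¹ + (p.dual k)⁻¹ = 1 :=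
  have : (p k).HolderConjugate (p.dual k) := .conjExponent (p.one_le k)
  ENNReal.HolderConjugate.inv_add_inv_eq_one (p k) (p.dual k)

/-- The modular `∑_{p(k) < ∞} |x(k)|^{p(k)} + sup_{p(k) = ∞} |x(k)|`. -/
def modular (p : Exponent) (x : ℕ → ℝ) : ℝ≥0∞ :=
  (∑' k, if p k = ∞ then 0 else ‖x k‖ₑ ^ (p k).toReal) + ⨆ k, if p k = ∞ then ‖x k‖ₑ else 0

/-- The Luxemburg norm `inf {l > 0 : ρ(x / l) ≤ 1}`. -/
def luxNorm (p : Exponent) (x : ℕ → ℝ) : ℝ :=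
  sInf {l : ℝ | 0 < l ∧ modular p (fun k => x k / l) ≤ 1}

theorem one_le_toReal (p : Exponent) {k : ℕ} (h : p k ≠ ∞) : 1 ≤ (p k).toReal := by
  simpa using ENNReal.toReal_mono h (p.one_le k)

theorem modular_convex (p : Exponent) {z u v : ℕ → ℝ} {a b : ℝ≥0∞} (hab : a + b = 1)
    (h : ∀ k, ‖z k‖ₑ ≤ a * ‖u k‖ₑ + b * ‖v k‖ₑ) :
    modular p z ≤ a * modular p u + b * modular p v := by
  have h1 : (∑' k, if p k = ∞ then 0 else ‖z k‖ₑ ^ (p k).toReal) ≤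
      a * (∑' k, if p k = ∞ then 0 else ‖u k‖ₑ ^ (p k).toReal) +
      b * (∑' k, if p k = ∞ then 0 else ‖v k‖ₑ ^ (p k).toReal) := by
    rw [← ENNReal.tsum_mul_left, ← ENNReal.tsum_mul_left, ← ENNReal.tsum_add]
    refine ENNReal.tsum_le_tsum fun k => ?_
    by_cases hk : p k = ∞
    · simp [hk]
    · have h1 := one_le_toReal p hk
      simp only [hk, if_false]
      exact (ENNReal.rpow_le_rpow (h k) (by linarith)).trans
        (ENNReal.rpow_arith_mean_le_arith_mean2_rpow _ _ _ _ hab h1)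
  have h2 : (⨆ k, if p k = ∞ then ‖z k‖ₑ else 0) ≤
      a * (⨆ k, if p k = ∞ then ‖u k‖ₑ else 0) + b * (⨆ k, if p k = ∞ then ‖v k‖ₑ else 0) := by
    refine iSup_le fun k => ?_
    by_cases hk : p k = ∞
    · simp only [hk, if_true]
      refine (h k).trans ?_
      gcongr
      · exact le_iSup_of_le k (by simp [hk])
      · exact le_iSup_of_le k (by simp [hk])
    · simp [hk]
  unfold modular
  refine (add_le_add h1 h2).trans (le_of_eq ?_)
  ring

theorem modular_zero (p : Exponent) : modular p (fun _ => 0) = 0 := by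
  have : ∀ k, (if p k = ∞ then 0 else ‖(0 : ℝ)‖ₑ ^ (p k).toReal) = 0 := by
    intro k
    split_ifs with hk
    · rfl
    · have := one_le_toReal p hk
      simp only [enorm_zero]
      exact ENNReal.zero_rpow_of_pos (by linarith)
  simp only [modular, this]
  simp

theorem modular_congr (p : Exponent) {x y : ℕ → ℝ} (h : ∀ k, |x k| = |y k|) :
    modular p x = modular p y := by
  have : ∀ k, ‖x k‖ₑ = ‖y k‖ₑ := fun k => by
    rw [← enorm_norm (x k), ← enorm_norm (y k), Real.norm_eq_abs, Real.norm_eq_abs, h k]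
  simp [modular, this]

theorem modular_add_div (p : Exponent) (x y : ℕ → ℝ) {l m : ℝ} (hl : 0 < l) (hm : 0 < m) :
    modular p (fun k => (x k + y k) / (l + m)) ≤
      ENNReal.ofReal (l / (l + m)) * modular p (fun k => x k / l) +
      ENNReal.ofReal (m / (l + m)) * modular p (fun k => y k / m) := by
  have hs : 0 < l + m := by linarith
  refine modular_convex p ?_ fun k => ?_
  · rw [← ENNReal.ofReal_add (by positivity) (by positivity), ← add_div, div_self hs.ne',
      ENNReal.ofReal_one]
  · simp only [← ofReal_norm, Real.norm_eq_abs]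
    rw [← ENNReal.ofReal_mul (by positivity), ← ENNReal.ofReal_mul (by positivity),
      ← ENNReal.ofReal_add (by positivity) (by positivity)]
    refine ENNReal.ofReal_le_ofReal ?_
    have h1 : l / (l + m) * |x k / l| = |x k| / (l + m) := by
      rw [abs_div, abs_of_pos hl]; field_simp
    have h2 : m / (l + m) * |y k / m| = |y k| / (l + m) := by
      rw [abs_div, abs_of_pos hm]; field_simp
    rw [h1, h2, abs_div, abs_of_pos hs, ← add_div]
    gcongr
    exact abs_add_le _ _

theorem modular_smul_div (p : Exponent) (x : ℕ → ℝ) {c l : ℝ} (hc : c ≠ 0) :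
    modular p (fun k => (c * x k) / (|c| * l)) = modular p (fun k => x k / l) := by
  refine modular_congr p fun k => ?_
  have : |c| ≠ 0 := by simpa using hc
  rw [abs_div, abs_mul, abs_mul, abs_abs, abs_div, mul_div_mul_left _ _ this]

theorem exists_modular_le_one (p : Exponent) (x : ℕ → ℝ) {l : ℝ} (hl : 0 < l)
    (h : modular p (fun k => x k / l) < ∞) :
    ∃ m : ℝ, 0 < m ∧ modular p (fun k => x k / m) ≤ 1 := by
  set M := (modular p (fun k => x k / l)).toReal with hM
  have hM0 : 0 ≤ M := ENNReal.toReal_nonneg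
  have hm : 0 < l * M + l := by positivity
  refine ⟨l + l * (M + 1), by positivity, ?_⟩
  have := modular_add_div p x (fun _ => 0) hl (show 0 < l * (M + 1) by positivity)
  simp only [add_zero, zero_div, modular_zero, mul_zero] at this
  refine this.trans ?_
  rw [← ENNReal.ofReal_toReal h.ne, ← hM, ← ENNReal.ofReal_mul (by positivity),
    ← ENNReal.ofReal_one]
  refine ENNReal.ofReal_le_ofReal ?_
  rw [div_mul_eq_mul_div, div_le_one (by positivity)]
  nlinarith

/-- The sequences `x` with `ρ(x / l) < ∞` for some `l > 0`, as a subspace of all sequences. -/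
def ellSubmodule (p : Exponent) : Submodule ℝ (ℕ → ℝ) where
  carrier := {x | ∃ l : ℝ, 0 < l ∧ modular p (fun k => x k / l) < ∞}
  zero_mem' := ⟨1, one_pos, by simp [modular_zero]⟩
  add_mem' := by
    rintro x y ⟨l, hl, hx⟩ ⟨m, hm, hy⟩
    refine ⟨l + m, by positivity, (modular_add_div p x y hl hm).trans_lt ?_⟩
    exact ENNReal.add_lt_top.2 ⟨ENNReal.mul_lt_top ENNReal.ofReal_lt_top hx,
      ENNReal.mul_lt_top ENNReal.ofReal_lt_top hy⟩
  smul_mem' := by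
    rintro c x ⟨l, hl, hx⟩
    by_cases hc : c = 0
    · exact ⟨1, one_pos, by simp [hc, modular_zero]⟩
    · refine ⟨|c| * l, by positivity, ?_⟩
      simpa [modular_smul_div p x hc] using hx

/-- The variable sequence space `ℓ^{p(·)}`. It is a type of its own, so that its only topology
is the one of the Luxemburg norm (and not the topology of pointwise convergence). -/
def Ell (p : Exponent) : Type := ellSubmodule p

instance (p : Exponent) : AddCommGroup (Ell p) := inferInstanceAs (AddCommGroup (ellSubmodule p))

instance (p : Exponent) : Module ℝ (Ell p) := inferInstanceAs (Module ℝ (ellSubmodule p))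

instance (p : Exponent) : CoeFun (Ell p) (fun _ => ℕ → ℝ) := ⟨fun x => x.1⟩

instance (p : Exponent) : Norm (Ell p) := ⟨fun x => luxNorm p x⟩

theorem Ell.exists_admissible {p : Exponent} (x : Ell p) :
    {l : ℝ | 0 < l ∧ modular p (fun k => x k / l) ≤ 1}.Nonempty := by
  obtain ⟨l, hl, h⟩ := x.2
  exact exists_modular_le_one p x hl h

theorem bddBelow_admissible (p : Exponent) (x : ℕ → ℝ) :
    BddBelow {l : ℝ | 0 < l ∧ modular p (fun k => x k / l) ≤ 1} :=
  ⟨0, fun _ h => h.1.le⟩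

theorem luxNorm_nonneg (p : Exponent) (x : ℕ → ℝ) : 0 ≤ luxNorm p x :=
  Real.sInf_nonneg fun _ h => h.1.le

theorem abs_le_of_modular_le_one (p : Exponent) {x : ℕ → ℝ} (h : modular p x ≤ 1) (k : ℕ) :
    |x k| ≤ 1 := by
  have key : ‖x k‖ₑ ≤ 1 := by
    by_cases hk : p k = ∞
    · refine le_trans ?_ (le_add_self.trans h)
      exact le_iSup_of_le k (by simp [hk])
    · have h1 := one_le_toReal p hk
      have h2 : ‖x k‖ₑ ^ (p k).toReal ≤ 1 := by
        refine le_trans ?_ (le_self_add.trans h)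
        refine le_trans ?_ (ENNReal.le_tsum k)
        simp [hk]
      by_contra hlt
      exact absurd h2 (not_le.2 (ENNReal.one_lt_rpow (not_le.1 hlt) (by linarith)))
  rw [← ofReal_norm, Real.norm_eq_abs] at key
  simpa using key

theorem luxNorm_smul_le {p : Exponent} (c : ℝ) (hc : c ≠ 0) (x : Ell p) :
    ‖c • x‖ ≤ |c| * ‖x‖ := by
  have hc' : 0 < |c| := abs_pos.2 hc
  rw [← div_le_iff₀' hc']
  refine le_csInf x.exists_admissible ?_
  rintro l ⟨hl, h⟩
  rw [div_le_iff₀' hc']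
  refine csInf_le (bddBelow_admissible p _) ⟨by positivity, ?_⟩
  have := modular_smul_div p x hc (l := l)
  exact (le_of_eq this).trans h

theorem Ell.core (p : Exponent) : NormedSpace.Core ℝ (Ell p) where
  norm_nonneg x := luxNorm_nonneg p x
  norm_smul c x := by
    rw [Real.norm_eq_abs]
    by_cases hc : c = 0
    · subst hc
      have : ‖(0 : Ell p)‖ = 0 := by
        refine le_antisymm (le_of_forall_pos_le_add fun e he => ?_) (luxNorm_nonneg p _)
        refine (csInf_le (bddBelow_admissible p _) ⟨he, ?_⟩).trans (by simp)
        have : modular p (fun k => (0 : Ell p) k / e) = 0 := by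
          rw [← modular_zero p]
          congr 1
          funext k
          exact zero_div e
        simp [this]
      simp [this]
    · refine le_antisymm (luxNorm_smul_le c hc x) ?_
      have h := luxNorm_smul_le c⁻¹ (inv_ne_zero hc) (c • x)
      rw [smul_smul, inv_mul_cancel₀ hc, one_smul, abs_inv] at h
      have hc' : 0 < |c| := abs_pos.2 hc
      rwa [inv_mul_eq_div, le_div_iff₀' hc'] at h
  norm_triangle x y := by
    refine le_of_forall_pos_le_add fun e he => ?_
    obtain ⟨l, ⟨hl, hx⟩, hl'⟩ := exists_lt_of_csInf_lt x.exists_admissible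
      (show luxNorm p x < luxNorm p x + e / 2 by linarith)
    obtain ⟨m, ⟨hm, hy⟩, hm'⟩ := exists_lt_of_csInf_lt y.exists_admissible
      (show luxNorm p y < luxNorm p y + e / 2 by linarith)
    have : ‖x + y‖ ≤ l + m := by
      refine csInf_le (bddBelow_admissible p _) ⟨by positivity, ?_⟩
      refine (modular_add_div p x y hl hm).trans ?_
      calc _ ≤ ENNReal.ofReal (l / (l + m)) * 1 + ENNReal.ofReal (m / (l + m)) * 1 := by gcongr
        _ = 1 := by
          rw [mul_one, mul_one, ← ENNReal.ofReal_add (by positivity) (by positivity), ← add_div,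
            div_self (by positivity), ENNReal.ofReal_one]
    change ‖x + y‖ ≤ luxNorm p x + luxNorm p y + e
    linarith
  norm_eq_zero_iff x := by
    constructor
    · intro h
      refine Subtype.ext (funext fun k => ?_)
      change x k = 0
      have : |x k| ≤ ‖x‖ := by
        refine le_csInf x.exists_admissible ?_
        rintro l ⟨hl, hx⟩
        have := abs_le_of_modular_le_one p hx k
        rwa [abs_div, abs_of_pos hl, div_le_one hl] at this
      rw [h] at this
      exact abs_nonpos_iff.1 this
    · rintro rfl
      refine le_antisymm (le_of_forall_pos_le_add fun e he => ?_) (luxNorm_nonneg p _)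
      refine (csInf_le (bddBelow_admissible p _) ⟨he, ?_⟩).trans (by simp)
      have : modular p (fun k => (0 : Ell p) k / e) = 0 := by
        rw [← modular_zero p]
        congr 1
        funext k
        exact zero_div e
      simp [this]

instance (p : Exponent) : NormedAddCommGroup (Ell p) := .ofCore (Ell.core p)

instance (p : Exponent) : NormedSpace ℝ (Ell p) := .ofCore (Ell.core p)

/-- `p_+(E) = sup_{k ∈ E} p(k)` (the essential supremum for the counting measure). -/
def pPlus (p : Exponent) (E : Set ℕ) : ℝ≥0∞ := ⨆ k ∈ E, p k

theorem pPlus_mono (p : Exponent) {E F : Set ℕ} (h : E ⊆ F) : pPlus p E ≤ pPlus p F :=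
  biSup_mono h

theorem pPlus_union (p : Exponent) (E F : Set ℕ) :
    pPlus p (E ∪ F) = max (pPlus p E) (pPlus p F) := iSup_union

/-- `ℓ^{p(·)}_b`: the `x ∈ ℓ^{p(·)}` with `p`-bounded support. -/
def ellB (p : Exponent) : Submodule ℝ (Ell p) where
  carrier := {x | pPlus p {k | x k ≠ 0} < ∞}
  zero_mem' := by
    have : {k | (0 : Ell p) k ≠ 0} = ∅ := Set.eq_empty_of_forall_notMem fun k hk => hk rfl
    change pPlus p _ < ∞
    rw [this]
    simp [pPlus]
  add_mem' := by
    intro x y hx hy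
    have h : {k | (x + y) k ≠ 0} ⊆ {k | x k ≠ 0} ∪ {k | y k ≠ 0} := Function.support_add x.1 y.1
    exact (pPlus_mono p h).trans_lt ((pPlus_union p _ _).trans_lt (max_lt hx hy))
  smul_mem' := by
    intro c x hx
    have h : {k | (c • x) k ≠ 0} ⊆ {k | x k ≠ 0} := fun k hk h0 =>
      hk ((congrArg (c * ·) h0).trans (mul_zero c))
    exact (pPlus_mono p h).trans_lt hx

/-- The germ space: the quotient of `ℓ^{p(·)}` by the closure of `ℓ^{p(·)}_b`, with the
quotient norm. -/
abbrev Germ (p : Exponent) : Type := Ell p ⧸ (ellB p).topologicalClosure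

/-- The total variation `|μ|(ℕ)` of a set function: the supremum of `∑ |μ(A_i)|` over all finite
families of pairwise disjoint subsets of `ℕ`. -/
def variation (μ : Set ℕ → ℝ) : ℝ≥0∞ :=
  ⨆ (P : Finset (Set ℕ)) (_ : (P : Set (Set ℕ)).PairwiseDisjoint id), ∑ A ∈ P, ‖μ A‖ₑ

theorem variation_add_le (μ ν : Set ℕ → ℝ) : variation (μ + ν) ≤ variation μ + variation ν := by
  refine iSup₂_le fun P hP => ?_
  calc ∑ A ∈ P, ‖(μ + ν) A‖ₑ ≤ ∑ A ∈ P, (‖μ A‖ₑ + ‖ν A‖ₑ) :=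
        Finset.sum_le_sum fun A _ => enorm_add_le _ _
    _ = ∑ A ∈ P, ‖μ A‖ₑ + ∑ A ∈ P, ‖ν A‖ₑ := Finset.sum_add_distrib
    _ ≤ _ := add_le_add (le_iSup₂_of_le P hP le_rfl) (le_iSup₂_of_le P hP le_rfl)

theorem variation_smul (c : ℝ) (μ : Set ℕ → ℝ) : variation (c • μ) = ‖c‖ₑ * variation μ := by
  simp only [variation, ENNReal.mul_iSup, Finset.mul_sum, Pi.smul_apply, smul_eq_mul, enorm_mul]

theorem variation_zero : variation 0 = 0 := by simp [variation]

theorem enorm_le_variation (μ : Set ℕ → ℝ) (A : Set ℕ) : ‖μ A‖ₑ ≤ variation μ :=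
  le_iSup₂_of_le {A} (by simp) (by simp)

/-- The purely finitely additive signed measures of finite total variation on the subsets of `ℕ`:
finitely additive set functions of finite variation that vanish on finite sets. -/
def pbaSubmodule : Submodule ℝ (Set ℕ → ℝ) where
  carrier := {μ | (∀ A B : Set ℕ, Disjoint A B → μ (A ∪ B) = μ A + μ B) ∧
    variation μ < ∞ ∧ ∀ E : Set ℕ, E.Finite → μ E = 0}
  zero_mem' := by simp [variation_zero]
  add_mem' := by
    rintro μ ν ⟨h1, h2, h3⟩ ⟨k1, k2, k3⟩
    refine ⟨fun A B h => ?_, (variation_add_le μ ν).trans_lt (ENNReal.add_lt_top.2 ⟨h2, k2⟩),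
      fun E hE => by simp [h3 E hE, k3 E hE]⟩
    simp only [Pi.add_apply, h1 A B h, k1 A B h]
    ring
  smul_mem' := by
    rintro c μ ⟨h1, h2, h3⟩
    refine ⟨fun A B h => ?_, ?_, fun E hE => by simp [h3 E hE]⟩
    · simp only [Pi.smul_apply, h1 A B h, smul_add]
    · rw [variation_smul]
      exact ENNReal.mul_lt_top enorm_lt_top h2

/-- The space `pba(𝓑(ℕ))`, normed by the total variation. -/
def Pba : Type := pbaSubmodule

instance : AddCommGroup Pba := inferInstanceAs (AddCommGroup pbaSubmodule)

instance : Module ℝ Pba := inferInstanceAs (Module ℝ pbaSubmodule)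

instance : CoeFun Pba (fun _ => Set ℕ → ℝ) := ⟨fun μ => μ.1⟩

instance : Norm Pba := ⟨fun μ => (variation μ).toReal⟩

theorem Pba.core : NormedSpace.Core ℝ Pba where
  norm_nonneg μ := ENNReal.toReal_nonneg
  norm_smul c μ := by
    change (variation (c • (μ : Set ℕ → ℝ))).toReal = ‖c‖ * (variation μ).toReal
    rw [variation_smul, ENNReal.toReal_mul, toReal_enorm]
  norm_triangle μ ν := by
    change (variation ((μ : Set ℕ → ℝ) + ν)).toReal ≤ (variation μ).toReal + (variation ν).toReal
    have hμ := μ.2.2.1.ne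
    have hν := ν.2.2.1.ne
    rw [← ENNReal.toReal_add hμ hν]
    exact ENNReal.toReal_mono (ENNReal.add_ne_top.2 ⟨hμ, hν⟩) (variation_add_le _ _)
  norm_eq_zero_iff μ := by
    constructor
    · intro h
      have h0 : variation μ = 0 :=
        ((ENNReal.toReal_eq_zero_iff _).1 h).resolve_right μ.2.2.1.ne
      refine Subtype.ext (funext fun A => ?_)
      have := enorm_le_variation μ A
      rw [h0] at this
      exact enorm_eq_zero.1 (le_antisymm this zero_le)
    · rintro rfl
      change (variation 0).toReal = 0
      simp [variation_zero]

instance : NormedAddCommGroup Pba := .ofCore Pba.core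

instance : NormedSpace ℝ Pba := .ofCore Pba.core

/-- The condition `∑_k B^{-p(k)} < ∞` for some `B > 1` (for a finite exponent). -/
def SummableCondition (p : Exponent) : Prop :=
  ∃ B : ℝ, 1 < B ∧ Summable fun k => B ^ (-(p k).toReal)

end VarSeq

end

open scoped ENNReal

noncomputable section

namespace VarSeq

open Filter Topology

/-! Every `x` in `ℓ^{p(·)}` satisfies `|x k| ≤ ‖x‖`, so the identity into `ℓ^∞` is always bounded.
The reverse bound is a statement about constants: the modular of the constant `1 / B` is `∑
B^{-p(k)}`, so the summability condition gives, after rescaling by convexity, a constant `1 / C` of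
modular at most one, and monotonicity of the modular then yields `‖x‖ ≤ C sup |x k|`. Conversely, if
the constant `1` lies in the space, the same series converges for some `l > 0`, and convergence
forces `l > 1`.

The dual is thus that of `ℓ^∞`. The values of a functional on the unit vectors form an absolutely
summable sequence; subtracting the pairing with that sequence leaves a functional vanishing on every
unit vector. Such functionals correspond to `pba` by `φ ↦ (A ↦ φ(1_A))`, with integration as
inverse, because step functions are dense (`dual_ext`). The sequence part is naturally `ℓ^1`, which
is `ℓ^{p'(·)}` with an equivalent norm: one inclusion holds for every exponent (`modular_le_tsum`),
the other is Young's inequality against the constant `1 / C` (`Ell.summable_and_tsum_le`).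

For the germ space, `p(k) → ∞` makes `ℓ^{p(·)}_b` the finitely supported sequences. The annihilator
of its closure is the set of functionals vanishing on unit vectors, hence again `pba`. -/

/-- The space `ℓ^∞` of bounded real sequences. -/
abbrev EllInfty : Type := lp (fun _ : ℕ => ℝ) ∞

/-- A sequence with an explicit bound, as an element of `ℓ^∞`. -/
def EllInfty.ofBound (x : ℕ → ℝ) (C : ℝ) (h : ∀ k, |x k| ≤ C) : EllInfty :=
  ⟨x, memℓp_infty ⟨C, by rintro _ ⟨k, rfl⟩; exact h k⟩⟩

theorem EllInfty.abs_apply_le (x : EllInfty) (k : ℕ) : |x k| ≤ ‖x‖ :=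
  lp.norm_apply_le_norm ENNReal.top_ne_zero x k

/-! ### Indicators and the set function of a functional on `ℓ^∞` -/

/-- The indicator sequence of a set, as an element of `ℓ^∞`. -/
def indic (A : Set ℕ) : EllInfty :=
  EllInfty.ofBound (A.indicator 1) 1 fun k => by
    by_cases h : k ∈ A <;> simp [h]

theorem indic_apply (A : Set ℕ) (k : ℕ) : indic A k = A.indicator 1 k := rfl

theorem indic_union {A B : Set ℕ} (h : Disjoint A B) : indic (A ∪ B) = indic A + indic B := by
  ext k
  exact congrFun (Set.indicator_union_of_disjoint h (1 : ℕ → ℝ)) k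

theorem sum_indic_apply (P : Finset (Set ℕ)) (s : Set ℕ → ℝ) (k : ℕ) :
    (∑ A ∈ P, s A • indic A : EllInfty) k = ∑ A ∈ P, s A * A.indicator 1 k := by
  rw [lp.coeFn_sum, Finset.sum_apply]
  rfl

theorem norm_sum_indic_le {P : Finset (Set ℕ)} (hP : (P : Set (Set ℕ)).PairwiseDisjoint id)
    {s : Set ℕ → ℝ} (hs : ∀ A, |s A| ≤ 1) : ‖(∑ A ∈ P, s A • indic A : EllInfty)‖ ≤ 1 := by
  refine lp.norm_le_of_forall_le zero_le_one fun k => ?_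
  rw [sum_indic_apply, Real.norm_eq_abs]
  by_cases hk : ∃ A ∈ P, k ∈ A
  · obtain ⟨A, hA, hkA⟩ := hk
    rw [Finset.sum_eq_single_of_mem A hA]
    · simpa [hkA] using hs A
    · intro B hB hBA
      have : k ∉ B := Set.disjoint_right.1 (hP hB hA hBA) hkA
      simp [this]
  · push Not at hk
    rw [Finset.sum_eq_zero fun A hA => by simp [hk A hA]]
    simp

/-- The set function `A ↦ φ(1_A)` of a functional on `ℓ^∞`. -/
def charge : StrongDual ℝ EllInfty →ₗ[ℝ] (Set ℕ → ℝ) where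
  toFun φ A := φ (indic A)
  map_add' _ _ := rfl
  map_smul' _ _ := rfl

theorem charge_apply (φ : StrongDual ℝ EllInfty) (A : Set ℕ) : charge φ A = φ (indic A) := rfl

theorem charge_union (φ : StrongDual ℝ EllInfty) {A B : Set ℕ} (h : Disjoint A B) :
    charge φ (A ∪ B) = charge φ A + charge φ B := by
  simp only [charge_apply, indic_union h, map_add]

/-- Testing `φ` on the combination of disjoint indicators with the signs of `φ(1_A)` as coefficients
turns the sum of absolute values into a single value of `φ` at a point of the unit ball. -/
theorem variation_charge_le (φ : StrongDual ℝ EllInfty) : variation (charge φ) ≤ ‖φ‖ₑ := by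
  refine iSup₂_le fun P hP => ?_
  have h1 : ∑ A ∈ P, |charge φ A| ≤ ‖φ‖ := by
    have h2 : ∑ A ∈ P, |charge φ A| =
        φ (∑ A ∈ P, (SignType.sign (charge φ A) : ℝ) • indic A) := by
      simp only [map_sum, map_smul, smul_eq_mul, ← charge_apply, sign_mul_self]
    rw [h2]
    refine (le_abs_self _).trans ((φ.le_opNorm _).trans ?_)
    refine mul_le_of_le_one_right (norm_nonneg _) (norm_sum_indic_le hP fun A => ?_)
    rcases SignType.sign (charge φ A) with _ | _ | _ <;> simp
  calc ∑ A ∈ P, ‖charge φ A‖ₑ = ENNReal.ofReal (∑ A ∈ P, |charge φ A|) := by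
        rw [ENNReal.ofReal_sum_of_nonneg fun _ _ => abs_nonneg _]
        exact Finset.sum_congr rfl fun A _ => by rw [Real.enorm_eq_ofReal_abs]
    _ ≤ ‖φ‖ₑ := by rw [← ofReal_norm]; exact ENNReal.ofReal_le_ofReal h1

/-- Functionals on `ℓ^∞` are determined by their values on indicators. -/
theorem dual_ext {φ : StrongDual ℝ EllInfty} (h : ∀ A, φ (indic A) = 0) : φ = 0 := by
  ext x
  refine abs_nonpos_iff.1 (le_of_forall_pos_le_add fun e he => ?_)
  -- The mesh of the step-function approximation; the `+ 1` in its denominator covers `φ = 0`.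
  obtain ⟨d, hd, hde⟩ : ∃ d : ℝ, 0 < d ∧ ‖φ‖ * d ≤ e := by
    refine ⟨e / (‖φ‖ + 1), by positivity, ?_⟩
    rw [mul_div_assoc', div_le_iff₀ (by positivity)]
    nlinarith [norm_nonneg φ]
  set f : ℕ → ℤ := fun k => ⌊x k / d⌋ with hf
  -- The extra one absorbs the rounding down in `f`, so that finitely many levels suffice.
  set N : ℤ := ⌈‖x‖ / d⌉ + 1 with hN
  have hfN : ∀ k, f k ∈ Finset.Icc (-N) N := by
    intro k
    have h1 := abs_le.1 (x.abs_apply_le k)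
    have h2 : x k / d ≤ ‖x‖ / d := by gcongr; exact h1.2
    have h3 : -(‖x‖ / d) ≤ x k / d := by rw [← neg_div]; gcongr; exact h1.1
    have h4 := Int.le_ceil (‖x‖ / d)
    have h5 := Int.floor_le (x k / d)
    have h6 := Int.lt_floor_add_one (x k / d)
    rw [Finset.mem_Icc]
    constructor
    · have : (-N : ℝ) < (f k + 1 : ℝ) := by rw [hN, hf]; push_cast; linarith
      have : -N < f k + 1 := by exact_mod_cast this
      omega
    · have : (f k : ℝ) ≤ N := by rw [hN, hf]; push_cast; linarith
      exact_mod_cast this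
  set s : EllInfty := ∑ j ∈ Finset.Icc (-N) N, (d * j : ℝ) • indic (f ⁻¹' {j}) with hs
  have hsk : ∀ k, s k = d * f k := by
    intro k
    rw [hs, lp.coeFn_sum, Finset.sum_apply, Finset.sum_eq_single_of_mem (f k) (hfN k)]
    · simp [indic_apply]
    · intro j _ hj
      simp [indic_apply, Set.indicator, hj.symm]
  have hφs : φ s = 0 := by
    rw [hs, map_sum]
    exact Finset.sum_eq_zero fun j _ => by rw [map_smul, h, smul_zero]
  have hxs : ‖x - s‖ ≤ d := by
    refine lp.norm_le_of_forall_le hd.le fun k => ?_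
    change |x k - s k| ≤ d
    have h5 := Int.floor_le (x k / d)
    have h6 := Int.lt_floor_add_one (x k / d)
    rw [le_div_iff₀ hd] at h5
    rw [div_lt_iff₀ hd] at h6
    rw [hsk, abs_le]
    constructor <;> simp only [hf] <;> nlinarith
  calc |φ x| = ‖φ (x - s)‖ := by rw [map_sub, hφs, sub_zero, Real.norm_eq_abs]
    _ ≤ ‖φ‖ * ‖x - s‖ := φ.le_opNorm _
    _ ≤ ‖φ‖ * d := by gcongr
    _ ≤ 0 + e := by linarith

/-! ### Finite additivity and variation over indexed families -/

theorem Pba.map_union (μ : Pba) {A B : Set ℕ} (h : Disjoint A B) : μ (A ∪ B) = μ A + μ B :=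
  μ.2.1 A B h

theorem Pba.map_finite (μ : Pba) {E : Set ℕ} (h : E.Finite) : μ E = 0 := μ.2.2.2 E h

theorem Pba.map_empty (μ : Pba) : μ ∅ = 0 := μ.map_finite Set.finite_empty

theorem Pba.map_biUnion (μ : Pba) {ι : Type*} [DecidableEq ι] (s : Finset ι) (f : ι → Set ℕ)
    (hf : ∀ i j, i ≠ j → Disjoint (f i) (f j)) : μ (⋃ i ∈ s, f i) = ∑ i ∈ s, μ (f i) := by
  induction s using Finset.induction_on with
  | empty => simp [Pba.map_empty]
  | insert a s ha ih =>
    rw [Finset.set_biUnion_insert, μ.map_union, ih, Finset.sum_insert ha]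
    exact Set.disjoint_iUnion₂_right.2 fun j hj => hf _ _ (by rintro rfl; exact ha hj)

theorem sum_abs_le_variation {μ : Set ℕ → ℝ} (h0 : μ ∅ = 0) (hμ : variation μ < ∞) {ι : Type*}
    (s : Finset ι) (f : ι → Set ℕ) (hf : ∀ i j, i ≠ j → Disjoint (f i) (f j)) :
    ∑ i ∈ s, |μ (f i)| ≤ (variation μ).toReal := by
  classical
  -- The variation ranges over finite sets of sets, so the family must be injective; disjointness
  -- gives this once empty members, which contribute nothing, are dropped.
  rw [← Finset.sum_filter_of_ne (p := fun i => (f i).Nonempty) fun i _ hi => by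
    by_contra h
    rw [Set.not_nonempty_iff_eq_empty] at h
    simp [h, h0] at hi]
  set t := s.filter fun i => (f i).Nonempty with ht
  have hinj : Set.InjOn f t := by
    intro i hi j _ hij
    by_contra hne
    have h1 := hf i j hne
    rw [← hij, disjoint_self, Set.bot_eq_empty] at h1
    have h2 := (Finset.mem_filter.1 hi).2
    simp [h1] at h2
  have hd : ((t.image f : Finset (Set ℕ)) : Set (Set ℕ)).PairwiseDisjoint id := by
    intro A hA B hB hAB
    obtain ⟨i, -, rfl⟩ := Finset.mem_image.1 (Finset.mem_coe.1 hA)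
    obtain ⟨j, -, rfl⟩ := Finset.mem_image.1 (Finset.mem_coe.1 hB)
    exact hf i j fun h => hAB (h ▸ rfl)
  rw [← Finset.sum_image (f := fun A => |μ A|) hinj, ← ENNReal.ofReal_le_iff_le_toReal hμ.ne,
    ENNReal.ofReal_sum_of_nonneg fun _ _ => abs_nonneg _]
  simp only [← Real.enorm_eq_ofReal_abs]
  exact le_iSup₂_of_le (t.image f) hd le_rfl

theorem Pba.sum_abs_le (μ : Pba) {ι : Type*} (s : Finset ι) (f : ι → Set ℕ)
    (hf : ∀ i j, i ≠ j → Disjoint (f i) (f j)) : ∑ i ∈ s, |μ (f i)| ≤ ‖μ‖ :=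
  sum_abs_le_variation μ.map_empty μ.2.2.1 s f hf

/-! ### Integration against purely finitely additive measures -/

section Integral

open Classical in
/-- The members of `F` containing `k`: the label of the atom of `k` in the algebra generated
by `F`. -/
def atomLabel (F : Finset (Set ℕ)) (k : ℕ) : Finset (Set ℕ) := F.filter (k ∈ ·)

/-- The atom of the algebra generated by `F` with label `G`. -/
def atom (F G : Finset (Set ℕ)) : Set ℕ := atomLabel F ⁻¹' {G}

theorem atom_disjoint (F : Finset (Set ℕ)) (G H : Finset (Set ℕ)) (h : G ≠ H) :
    Disjoint (atom F G) (atom F H) :=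
  (Set.disjoint_singleton.2 h).preimage _

/-- A point of a set of naturals (`0` for the empty set). -/
def point (A : Set ℕ) : ℕ := sInf A

/-- The Riemann sum of `x` over the atoms of the algebra generated by `F`. -/
def riemannSum (μ : Pba) (x : EllInfty) (F : Finset (Set ℕ)) : ℝ :=
  ∑ G ∈ F.powerset, x (point (atom F G)) * μ (atom F G)

theorem abs_riemannSum_le (μ : Pba) (x : EllInfty) (F : Finset (Set ℕ)) :
    |riemannSum μ x F| ≤ ‖μ‖ * ‖x‖ := by
  calc |riemannSum μ x F| ≤ ∑ G ∈ F.powerset, |x (point (atom F G)) * μ (atom F G)| :=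
        Finset.abs_sum_le_sum_abs _ _
    _ ≤ ∑ G ∈ F.powerset, ‖x‖ * |μ (atom F G)| := Finset.sum_le_sum fun G _ => by
        rw [abs_mul]
        exact mul_le_mul_of_nonneg_right (x.abs_apply_le _) (abs_nonneg _)
    _ ≤ ‖x‖ * ‖μ‖ := by
        rw [← Finset.mul_sum]
        exact mul_le_mul_of_nonneg_left (μ.sum_abs_le _ _ (atom_disjoint F)) (norm_nonneg _)
    _ = _ := mul_comm _ _

/-- Once `A` belongs to `F`, it is a union of atoms, namely those whose label contains `A`, so the
sampled values of the indicator are exact. -/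
theorem riemannSum_indic (μ : Pba) {A : Set ℕ} {F : Finset (Set ℕ)} (hA : A ∈ F) :
    riemannSum μ (indic A) F = μ A := by
  classical
  have hU : A = ⋃ G ∈ F.powerset.filter (A ∈ ·), atom F G := by
    ext k
    simp [atom, atomLabel, hA]
  conv_rhs => rw [hU, μ.map_biUnion _ _ (atom_disjoint F), Finset.sum_filter]
  refine Finset.sum_congr rfl fun G _ => ?_
  -- On an empty atom the default sample point is meaningless, but the measure is zero there.
  rcases (atom F G).eq_empty_or_nonempty with h | h
  · simp [h, Pba.map_empty]
  · have h1 : atomLabel F (point (atom F G)) = G := Nat.sInf_mem h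
    have h2 : point (atom F G) ∈ A ↔ A ∈ G := by
      conv_rhs => rw [← h1]
      simp [atomLabel, hA]
    by_cases h3 : A ∈ G
    · simp [indic_apply, h3, h2.2 h3]
    · simp [indic_apply, h3, mt h2.1 h3]

/-- An ultrafilter finer than the refinement order of finite families of sets. -/
def refinement : Ultrafilter (Finset (Set ℕ)) := Ultrafilter.of atTop

/-- The sums stay in a compact interval, so an ultrafilter limit exists without any Cauchy estimate.
-/
theorem exists_tendsto_riemannSum (μ : Pba) (x : EllInfty) :
    ∃ a, Tendsto (riemannSum μ x) refinement (𝓝 a) := by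
  have h := (isCompact_Icc (a := -(‖μ‖ * ‖x‖)) (b := ‖μ‖ * ‖x‖)).ultrafilter_le_nhds
    (refinement.map (riemannSum μ x)) (by
      rw [le_principal_iff, Ultrafilter.coe_map, mem_map]
      exact univ_mem' fun F => abs_le.1 (abs_riemannSum_le μ x F))
  obtain ⟨a, -, ha⟩ := h
  exact ⟨a, ha⟩

/-- The integral of a bounded sequence against a finitely additive measure. -/
def integral (μ : Pba) (x : EllInfty) : ℝ := (exists_tendsto_riemannSum μ x).choose

theorem tendsto_integral (μ : Pba) (x : EllInfty) :
    Tendsto (riemannSum μ x) refinement (𝓝 (integral μ x)) :=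
  (exists_tendsto_riemannSum μ x).choose_spec

theorem abs_integral_le (μ : Pba) (x : EllInfty) : |integral μ x| ≤ ‖μ‖ * ‖x‖ :=
  le_of_tendsto (tendsto_integral μ x).abs (univ_mem' fun F => abs_riemannSum_le μ x F)

theorem integral_indic (μ : Pba) (A : Set ℕ) : integral μ (indic A) = μ A := by
  refine tendsto_nhds_unique (tendsto_integral μ _) (tendsto_const_nhds.congr' ?_)
  have h : ∀ᶠ F in (refinement : Filter (Finset (Set ℕ))), {A} ≤ F :=
    Ultrafilter.of_le atTop (eventually_ge_atTop _)
  filter_upwards [h] with F hF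
  exact (riemannSum_indic μ (Finset.singleton_subset_iff.1 hF)).symm

/-- Integration as a map into the dual of `ℓ^∞`. -/
def integralCLM : Pba →L[ℝ] StrongDual ℝ EllInfty :=
  LinearMap.mkContinuous₂ (LinearMap.mk₂ ℝ integral
    -- All four linearity laws hold for the sums at each fixed `F` and pass to the limit along the
    -- common ultrafilter.
    (fun μ ν x => tendsto_nhds_unique (tendsto_integral _ x)
      (((tendsto_integral μ x).add (tendsto_integral ν x)).congr fun F => by
        simp only [riemannSum, ← Finset.sum_add_distrib, ← mul_add]; rfl))
    (fun c μ x => tendsto_nhds_unique (tendsto_integral _ x)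
      (((tendsto_integral μ x).const_mul c).congr fun F => by
        simp only [riemannSum, Finset.mul_sum]
        refine Finset.sum_congr rfl fun G _ => ?_
        rw [mul_left_comm]; rfl))
    (fun μ x y => tendsto_nhds_unique (tendsto_integral _ _)
      (((tendsto_integral μ x).add (tendsto_integral μ y)).congr fun F => by
        simp only [riemannSum, ← Finset.sum_add_distrib, ← add_mul]; rfl))
    (fun c μ x => tendsto_nhds_unique (tendsto_integral _ _)
      (((tendsto_integral μ x).const_mul c).congr fun F => by
        simp only [riemannSum, Finset.mul_sum, ← mul_assoc]; rfl))) 1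
    fun μ x => by simpa using abs_integral_le μ x

theorem integralCLM_indic (μ : Pba) (A : Set ℕ) : integralCLM μ (indic A) = μ A :=
  integral_indic μ A

end Integral

/-! ### The summability condition and the identification with `ℓ^∞` -/

theorem modular_mono (p : Exponent) {x y : ℕ → ℝ} (h : ∀ k, |x k| ≤ |y k|) :
    modular p x ≤ modular p y := by
  have := modular_convex p (z := x) (u := y) (v := y) (a := 1) (b := 0) (by simp) fun k => by
    simpa [Real.enorm_eq_ofReal_abs] using ENNReal.ofReal_le_ofReal (h k)
  simpa using this

theorem modular_eq_tsum {p : Exponent} (hp : ∀ k, p k ≠ ∞) (x : ℕ → ℝ) :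
    modular p x = ∑' k, ‖x k‖ₑ ^ (p k).toReal := by
  simp [modular, hp]

theorem Ell.abs_apply_le {p : Exponent} (x : Ell p) (k : ℕ) : |x k| ≤ ‖x‖ := by
  refine le_csInf x.exists_admissible ?_
  rintro l ⟨hl, hx⟩
  have := abs_le_of_modular_le_one p hx k
  rwa [abs_div, abs_of_pos hl, div_le_one hl] at this

theorem Ell.norm_le {p : Exponent} (x : Ell p) {l : ℝ} (hl : 0 < l)
    (h : modular p (fun k => x k / l) ≤ 1) : ‖x‖ ≤ l :=
  csInf_le (bddBelow_admissible p _) ⟨hl, h⟩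

/-- Under the summability condition some nonzero constant has modular at most one. -/
theorem SummableCondition.exists_modular_const_le_one {p : Exponent} (hp : ∀ k, p k ≠ ∞)
    (h : SummableCondition p) : ∃ C : ℝ, 0 < C ∧ modular p (fun _ => 1 / C) ≤ 1 := by
  obtain ⟨B, hB, hs⟩ := h
  refine exists_modular_le_one p (fun _ => 1) (l := B) (by linarith) ?_
  have h1 : ∀ k, ‖1 / B‖ₑ ^ (p k).toReal = ENNReal.ofReal (B ^ (-(p k).toReal)) := by
    intro k
    rw [Real.enorm_eq_ofReal (by positivity),
      ENNReal.ofReal_rpow_of_nonneg (by positivity) ENNReal.toReal_nonneg, one_div,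
      Real.inv_rpow (by linarith), Real.rpow_neg (by linarith)]
  rw [modular_eq_tsum hp]
  simp only [h1]
  exact hs.tsum_ofReal_lt_top

theorem modular_div_le_one {p : Exponent} {C : ℝ} (hC : 0 < C)
    (h : modular p (fun _ => 1 / C) ≤ 1) {x : ℕ → ℝ} {M : ℝ} (hM : 0 < M)
    (hx : ∀ k, |x k| ≤ M) : modular p (fun k => x k / (C * M)) ≤ 1 := by
  refine (modular_mono p fun k => ?_).trans h
  rw [abs_div, abs_of_pos (mul_pos hC hM), abs_of_pos (one_div_pos.2 hC), ← div_div, div_right_comm]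
  gcongr
  exact div_le_one_of_le₀ (hx k) hM.le

/-- The identity map `ℓ^{p(·)} → ℓ^∞` is an isomorphism if some nonzero constant has modular at
most one. -/
def ellEquivOfConst (p : Exponent) (C : ℝ) (hC : 0 < C) (h : modular p (fun _ => 1 / C) ≤ 1) :
    Ell p ≃L[ℝ] EllInfty :=
  ContinuousLinearEquiv.equivOfInverse
    (LinearMap.mkContinuous
      { toFun := fun x => EllInfty.ofBound x ‖x‖ x.abs_apply_le
        map_add' := fun _ _ => rfl
        map_smul' := fun _ _ => rfl } 1 fun x => by
      rw [one_mul]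
      exact lp.norm_le_of_forall_le (norm_nonneg x) x.abs_apply_le)
    (LinearMap.mkContinuous
      { toFun := fun x => (⟨x, C * (‖x‖ + 1), by positivity,
          (modular_div_le_one hC h (by positivity) fun k =>
            (x.abs_apply_le k).trans (by linarith)).trans_lt ENNReal.one_lt_top⟩ : ellSubmodule p)
        map_add' := fun _ _ => rfl
        map_smul' := fun _ _ => rfl } C fun x => by
      refine le_of_forall_pos_le_add fun e he => ?_
      -- The slack keeps the scale positive when `x = 0`; multiplied by `C` it costs exactly `e`.
      have h1 : 0 < ‖x‖ + e / C := by positivity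
      refine (Ell.norm_le _ (mul_pos hC h1) (modular_div_le_one hC h h1 fun k =>
        (x.abs_apply_le k).trans (by have : 0 < e / C := by positivity
                                     linarith))).trans (le_of_eq ?_)
      field_simp)
    (fun _ => rfl) fun _ => rfl

theorem ellEquivOfConst_apply (p : Exponent) (C : ℝ) (hC : 0 < C)
    (h : modular p (fun _ => 1 / C) ≤ 1) (x : Ell p) (k : ℕ) :
    ellEquivOfConst p C hC h x k = x k := rfl

/-- If `ℓ^{p(·)}` contains the constant sequence `1`, then the summability condition holds. -/
theorem summableCondition_of_one_mem {p : Exponent} (hp : ∀ k, p k ≠ ∞)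
    (h : (fun _ => 1 : ℕ → ℝ) ∈ ellSubmodule p) : SummableCondition p := by
  obtain ⟨l, hl, h⟩ := h
  rw [modular_eq_tsum hp] at h
  have h1 : ∀ k, ‖1 / l‖ₑ ^ (p k).toReal = ENNReal.ofReal (l ^ (-(p k).toReal)) := by
    intro k
    rw [Real.enorm_eq_ofReal (by positivity),
      ENNReal.ofReal_rpow_of_nonneg (by positivity) ENNReal.toReal_nonneg, one_div,
      Real.inv_rpow hl.le, Real.rpow_neg hl.le]
  have hs : Summable fun k => l ^ (-(p k).toReal) := by
    have := ENNReal.summable_toReal h.ne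
    simp only [h1] at this
    exact this.congr fun k => ENNReal.toReal_ofReal (by positivity)
  refine ⟨l, ?_, hs⟩
  -- For `l ≤ 1` every term is at least one, so the terms could not tend to zero.
  by_contra! hl1
  have h2 := hs.tendsto_atTop_zero
  have h3 : (1 : ℝ) ≤ 0 := ge_of_tendsto' h2 fun k =>
    Real.one_le_rpow_of_pos_of_le_one_of_nonpos hl hl1 (by simp)
  linarith

/-- Under the summability condition, sets on which the exponent is bounded are finite. -/
theorem SummableCondition.finite_of_pPlus_lt_top {p : Exponent} (h : SummableCondition p)
    {E : Set ℕ} (hE : pPlus p E < ∞) : E.Finite := by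
  obtain ⟨B, hB, hs⟩ := h
  -- On `E` the terms are bounded below by this positive constant, while a summable family falls
  -- below it off a finite set.
  have h1 : ∀ᶠ k in cofinite, B ^ (-(p k).toReal) < B ^ (-(pPlus p E).toReal) :=
    hs.tendsto_cofinite_zero.eventually_lt_const (by positivity)
  refine (eventually_cofinite.1 h1).subset fun k hk => ?_
  have h2 : (p k).toReal ≤ (pPlus p E).toReal :=
    ENNReal.toReal_mono hE.ne (le_iSup₂_of_le k hk le_rfl)
  exact not_lt.2 (Real.rpow_le_rpow_of_exponent_le hB.le (by linarith))

/-! ### Comparison of `ℓ^{p'(·)}` with `ℓ^1` -/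

/-- All entries are at most one, so raising to a power `≥ 1` only decreases them; on the indices
with infinite exponent the supremum is at most the sum. -/
theorem modular_le_tsum (q : Exponent) {y : ℕ → ℝ} (hy : ∑' k, ‖y k‖ₑ ≤ 1) :
    modular q y ≤ 1 := by
  have h1 : ∀ k, ‖y k‖ₑ ≤ 1 := fun k => (ENNReal.le_tsum k).trans hy
  refine le_trans ?_ hy
  calc modular q y ≤ (∑' k, if q k = ∞ then 0 else ‖y k‖ₑ) +
        ∑' k, if q k = ∞ then ‖y k‖ₑ else 0 := by
        refine add_le_add (ENNReal.tsum_le_tsum fun k => ?_) (iSup_le fun k => ENNReal.le_tsum k)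
        split_ifs with hk
        · rfl
        · exact ENNReal.rpow_le_self_of_le_one (h1 k) (one_le_toReal q hk)
    _ = ∑' k, ‖y k‖ₑ := by
        rw [← ENNReal.tsum_add]
        refine tsum_congr fun k => ?_
        split_ifs <;> simp

theorem modular_div_le_one_of_tsum_le (q : Exponent) {y : ℕ → ℝ} (hy : Summable fun k => |y k|)
    {l : ℝ} (hl : 0 < l) (h : ∑' k, |y k| ≤ l) : modular q (fun k => y k / l) ≤ 1 := by
  refine modular_le_tsum q ?_
  have h1 : ∀ k, ‖y k / l‖ₑ = ENNReal.ofReal (|y k| / l) := fun k => by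
    rw [Real.enorm_eq_ofReal_abs, abs_div, abs_of_pos hl]
  simp only [h1]
  rw [← ENNReal.ofReal_tsum_of_nonneg (fun k => by positivity) (hy.div_const l), tsum_div_const]
  simpa using div_le_one_of_le₀ h hl.le

/-- A summable sequence, as an element of `ℓ^{q(·)}`. -/
def Ell.ofSummable (q : Exponent) (y : ℕ → ℝ) (hy : Summable fun k => |y k|) : Ell q :=
  (⟨y, ∑' k, |y k| + 1, add_pos_of_nonneg_of_pos (tsum_nonneg fun _ => abs_nonneg _) one_pos,
    (modular_div_le_one_of_tsum_le q hy
      (add_pos_of_nonneg_of_pos (tsum_nonneg fun _ => abs_nonneg _) one_pos)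
      (by linarith)).trans_lt ENNReal.one_lt_top⟩ : ellSubmodule q)

theorem Ell.norm_ofSummable_le (q : Exponent) (y : ℕ → ℝ) (hy : Summable fun k => |y k|) :
    ‖Ell.ofSummable q y hy‖ ≤ ∑' k, |y k| := by
  refine le_of_forall_pos_le_add fun e he => ?_
  exact Ell.norm_le _ (add_pos_of_nonneg_of_pos (tsum_nonneg fun _ => abs_nonneg _) he)
    (modular_div_le_one_of_tsum_le q hy
      (add_pos_of_nonneg_of_pos (tsum_nonneg fun _ => abs_nonneg _) he) (by linarith))

/-- Young's inequality with its factors `1 / p` and `1 / p'` discarded, shaped so that summation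
over `k` yields the two modulars. Where `p' = ∞` one has `p = 1`, and the bound `|y k| ≤ 1` replaces
Young. -/
theorem enorm_mul_le_young {p : Exponent} (hp : ∀ k, p k ≠ ∞) {y : ℕ → ℝ}
    (hy : modular p.dual y ≤ 1) (a : ℝ≥0∞) (k : ℕ) :
    ‖y k‖ₑ * a ≤ (if p.dual k = ∞ then 0 else ‖y k‖ₑ ^ (p.dual k).toReal) +
      a ^ (p k).toReal := by
  have hc := p.inv_add_inv_dual k
  split_ifs with hk
  · rw [hk, ENNReal.inv_top, add_zero, ENNReal.inv_eq_one] at hc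
    have h1 : ‖y k‖ₑ ≤ 1 := by
      rw [Real.enorm_eq_ofReal_abs]
      simpa using abs_le_of_modular_le_one _ hy k
    simpa [hc] using mul_le_mul_left h1 a
  · by_cases hk1 : p k = 1
    · rw [hk1, inv_one] at hc
      have : (p.dual k)⁻¹ = 0 := by
        have h2 : (1 : ℝ≥0∞) + (p.dual k)⁻¹ = 1 + 0 := by rw [hc, add_zero]
        exact (ENNReal.add_right_inj ENNReal.one_ne_top).1 h2
      exact absurd (ENNReal.inv_eq_zero.1 this) hk
    · have h1 : 1 < p k := lt_of_le_of_ne (p.one_le k) (Ne.symm hk1)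
      have h2 : 1 < (p k).toReal := by
        simpa using (ENNReal.toReal_lt_toReal ENNReal.one_ne_top (hp k)).2 h1
      have hpos : 0 < (p.dual k).toReal := by
        have := one_le_toReal p.dual hk
        linarith
      have hconj : (p.dual k).toReal.HolderConjugate (p k).toReal := by
        refine Real.HolderConjugate.symm (Real.holderConjugate_iff.2 ⟨h2, ?_⟩)
        have := congrArg ENNReal.toReal hc
        rw [ENNReal.toReal_add (ENNReal.inv_ne_top.2 (zero_lt_one.trans h1).ne')
          (ENNReal.inv_ne_top.2 (zero_lt_one.trans_le (p.dual.one_le k)).ne')] at this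
        simpa using this
      refine (ENNReal.young_inequality _ _ hconj).trans (add_le_add ?_ ?_)
      · refine ENNReal.div_le_of_le_mul (le_mul_of_one_le_right zero_le ?_)
        simpa using one_le_toReal p.dual hk
      · refine ENNReal.div_le_of_le_mul (le_mul_of_one_le_right zero_le ?_)
        simpa using h2.le

/-- The sum is `C` times the pairing of `y` with the constant `1 / C`. Young bounds that pairing by
two modulars, each at most one, whence the factor `2`. -/
theorem tsum_enorm_le_of_modular_dual_le_one {p : Exponent} (hp : ∀ k, p k ≠ ∞) {C : ℝ}
    (hC : 0 < C) (h : modular p (fun _ => 1 / C) ≤ 1) {y : ℕ → ℝ}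
    (hy : modular p.dual y ≤ 1) : ∑' k, ‖y k‖ₑ ≤ ENNReal.ofReal (2 * C) := by
  have h1 : ENNReal.ofReal C * ‖1 / C‖ₑ = 1 := by
    rw [Real.enorm_eq_ofReal (by positivity), ← ENNReal.ofReal_mul hC.le, mul_one_div_cancel hC.ne',
      ENNReal.ofReal_one]
  calc ∑' k, ‖y k‖ₑ = ENNReal.ofReal C * ∑' k, ‖y k‖ₑ * ‖1 / C‖ₑ := by
        rw [ENNReal.tsum_mul_right, mul_left_comm, h1, mul_one]
    _ ≤ ENNReal.ofReal C * (modular p.dual y + modular p (fun _ => 1 / C)) := by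
        gcongr
        refine (ENNReal.tsum_le_tsum fun k => enorm_mul_le_young hp hy ‖1 / C‖ₑ k).trans ?_
        rw [ENNReal.tsum_add, modular_eq_tsum hp]
        gcongr
        exact le_self_add
    _ ≤ ENNReal.ofReal C * (1 + 1) := by gcongr
    _ = _ := by rw [one_add_one_eq_two, mul_comm, ENNReal.ofReal_mul zero_le_two]; simp

/-- Under the summability condition, `ℓ^{p'(·)}` embeds into `ℓ^1`. -/
theorem Ell.summable_and_tsum_le {p : Exponent} (hp : ∀ k, p k ≠ ∞) {C : ℝ}
    (hC : 0 < C) (h : modular p (fun _ => 1 / C) ≤ 1) (y : Ell p.dual) :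
    (Summable fun k => |y k|) ∧ ∑' k, |y k| ≤ 2 * C * ‖y‖ := by
  have key : ∀ l : ℝ, 0 < l → modular p.dual (fun k => y k / l) ≤ 1 →
      ∑' k, ENNReal.ofReal |y k| ≤ ENNReal.ofReal (2 * C * l) := by
    intro l hl hy
    have h1 : ∀ k, ENNReal.ofReal |y k| = ‖y k / l‖ₑ * ENNReal.ofReal l := fun k => by
      rw [Real.enorm_eq_ofReal_abs, ← ENNReal.ofReal_mul (abs_nonneg _), abs_div, abs_of_pos hl,
        div_mul_cancel₀ _ hl.ne']
    simp only [h1]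
    rw [ENNReal.tsum_mul_right, ENNReal.ofReal_mul (by positivity)]
    gcongr
    exact tsum_enorm_le_of_modular_dual_le_one hp hC h hy
  have hs : Summable fun k => |y k| := by
    obtain ⟨l, hl, hy⟩ := y.exists_admissible
    have := ENNReal.summable_toReal ((key l hl hy).trans_lt ENNReal.ofReal_lt_top).ne
    exact this.congr fun k => ENNReal.toReal_ofReal (abs_nonneg _)
  refine ⟨hs, ?_⟩
  -- Dividing by `2 * C` isolates the Luxemburg infimum, so the bound need only be checked at each
  -- admissible `l`.
  rw [← div_le_iff₀' (by positivity)]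
  refine le_csInf y.exists_admissible ?_
  rintro l ⟨hl, hy⟩
  rw [div_le_iff₀' (by positivity), ← ENNReal.ofReal_le_ofReal_iff (by positivity),
    ENNReal.ofReal_tsum_of_nonneg (fun _ => abs_nonneg _) hs]
  exact key l hl hy

/-! ### Singular functionals and `pba` -/

/-- The functionals on `ℓ^∞` that vanish on the unit vectors. -/
def singularDual : Submodule ℝ (StrongDual ℝ EllInfty) where
  carrier := {φ | ∀ k, φ (indic {k}) = 0}
  zero_mem' _ := rfl
  add_mem' h1 h2 k := by simp [h1 k, h2 k]
  smul_mem' c _ h k := by simp [h k]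

theorem indic_empty : indic ∅ = 0 := by
  ext k
  simp [indic_apply]

theorem charge_empty (φ : StrongDual ℝ EllInfty) : charge φ ∅ = 0 := by
  rw [charge_apply, indic_empty, map_zero]

theorem charge_finite {φ : StrongDual ℝ EllInfty} (hφ : φ ∈ singularDual) {E : Set ℕ}
    (hE : E.Finite) : charge φ E = 0 := by
  induction E, hE using Set.Finite.induction_on with
  | empty => exact charge_empty φ
  | @insert a s ha _ ih =>
    rw [Set.insert_eq, charge_union φ (Set.disjoint_singleton_left.2 ha), ih, add_zero]
    exact hφ a

theorem variation_charge_lt_top (φ : StrongDual ℝ EllInfty) : variation (charge φ) < ∞ :=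
  (variation_charge_le φ).trans_lt enorm_lt_top

theorem toReal_variation_charge_le (φ : StrongDual ℝ EllInfty) :
    (variation (charge φ)).toReal ≤ ‖φ‖ := by
  simpa using ENNReal.toReal_mono enorm_ne_top (variation_charge_le φ)

/-- The set function of a functional vanishing on the unit vectors, as an element of `pba`. -/
def pbaCharge (φ : singularDual) : Pba :=
  (⟨charge φ.1, fun _ _ h => charge_union φ.1 h, variation_charge_lt_top φ.1,
    fun _ hE => charge_finite φ.2 hE⟩ : pbaSubmodule)

theorem norm_pbaCharge_le (φ : singularDual) : ‖pbaCharge φ‖ ≤ ‖φ‖ :=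
  toReal_variation_charge_le φ.1

theorem Pba.ext {μ ν : Pba} (h : ∀ A, μ A = ν A) : μ = ν := Subtype.ext (funext h)

theorem Pba.add_apply (μ ν : Pba) (A : Set ℕ) : (μ + ν) A = μ A + ν A := rfl

theorem Pba.smul_apply (c : ℝ) (μ : Pba) (A : Set ℕ) : (c • μ) A = c * μ A := rfl

/-- The map `φ ↦ pbaCharge φ` as a continuous linear map. -/
def chargeCLM : singularDual →L[ℝ] Pba :=
  LinearMap.mkContinuous
    { toFun := pbaCharge
      map_add' := fun φ ψ => Pba.ext fun A => by
        rw [Pba.add_apply]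
        rfl
      map_smul' := fun c φ => Pba.ext fun A => by
        rw [RingHom.id_apply, Pba.smul_apply]
        rfl } 1 fun φ =>
    (norm_pbaCharge_le φ).trans_eq (one_mul _).symm

theorem chargeCLM_apply (φ : singularDual) (A : Set ℕ) : chargeCLM φ A = φ.1 (indic A) := rfl

theorem integralCLM_mem_singularDual (μ : Pba) : integralCLM μ ∈ singularDual := fun k => by
  rw [integralCLM_indic, μ.map_finite (Set.finite_singleton k)]

/-- Both sides agree on indicators, which determine a functional by density of step functions. -/
theorem integralCLM_chargeCLM (φ : singularDual) : integralCLM (chargeCLM φ) = φ.1 := by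
  refine sub_eq_zero.1 (dual_ext fun A => ?_)
  rw [sub_apply, integralCLM_indic, chargeCLM_apply, sub_self]

/-- The functionals on `ℓ^∞` vanishing on the unit vectors are the purely finitely additive
measures. -/
def singularDualEquiv : singularDual ≃L[ℝ] Pba :=
  ContinuousLinearEquiv.equivOfInverse chargeCLM
    (integralCLM.codRestrict singularDual integralCLM_mem_singularDual)
    (fun φ => Subtype.ext (integralCLM_chargeCLM φ))
    fun μ => Subtype.ext <| funext fun A => integralCLM_indic μ A

/-! ### Splitting off the summable part of a functional on `ℓ^∞` -/

/-- Singletons are disjoint, so this is an instance of the variation bound for the set function of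
`φ`. -/
theorem sum_abs_apply_indic_le (φ : StrongDual ℝ EllInfty) (s : Finset ℕ) :
    ∑ k ∈ s, |φ (indic {k})| ≤ ‖φ‖ :=
  (sum_abs_le_variation (charge_empty φ) (variation_charge_lt_top φ) s (fun k => {k})
    fun _ _ h => Set.disjoint_singleton.2 h).trans (toReal_variation_charge_le φ)

theorem summable_abs_apply_indic (φ : StrongDual ℝ EllInfty) :
    Summable fun k => |φ (indic {k})| :=
  summable_of_sum_le (fun _ => abs_nonneg _) (sum_abs_apply_indic_le φ)

/-- The values of a functional on the unit vectors. -/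
def coeffs (q : Exponent) : StrongDual ℝ EllInfty →L[ℝ] Ell q :=
  LinearMap.mkContinuous
    { toFun := fun φ => Ell.ofSummable q _ (summable_abs_apply_indic φ)
      map_add' := fun _ _ => rfl
      map_smul' := fun _ _ => rfl } 1 fun φ => by
    rw [one_mul]
    exact (Ell.norm_ofSummable_le q _ (summable_abs_apply_indic φ)).trans
      ((summable_abs_apply_indic φ).tsum_le_of_sum_le (sum_abs_apply_indic_le φ))

theorem coeffs_apply (q : Exponent) (φ : StrongDual ℝ EllInfty) (k : ℕ) :
    coeffs q φ k = φ (indic {k}) := rfl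

theorem summable_abs_mul {y : ℕ → ℝ} (hy : Summable fun k => |y k|) (x : EllInfty) :
    Summable fun k => |y k * x k| := by
  refine (hy.mul_right ‖x‖).of_nonneg_of_le (fun _ => abs_nonneg _) fun k => ?_
  rw [abs_mul]
  exact mul_le_mul_of_nonneg_left (x.abs_apply_le k) (abs_nonneg _)

theorem abs_tsum_mul_le {y : ℕ → ℝ} (hy : Summable fun k => |y k|) (x : EllInfty) :
    |∑' k, y k * x k| ≤ (∑' k, |y k|) * ‖x‖ := by
  have h1 : ∀ k, ‖y k * x k‖ ≤ |y k| * ‖x‖ := fun k => by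
    rw [Real.norm_eq_abs, abs_mul]
    exact mul_le_mul_of_nonneg_left (x.abs_apply_le k) (abs_nonneg _)
  have h2 : HasSum (fun k => |y k| * ‖x‖) ((∑' k, |y k|) * ‖x‖) := hy.hasSum.mul_right ‖x‖
  exact tsum_of_norm_bounded h2 h1

/-- The pairing `⟨y, x⟩ = ∑ y(k) x(k)` of `ℓ^{q(·)}` with `ℓ^∞`, if `ℓ^{q(·)}` embeds into
`ℓ^1`. -/
def pairing (q : Exponent) (K : ℝ)
    (hK : ∀ y : Ell q, (Summable fun k => |y k|) ∧ ∑' k, |y k| ≤ K * ‖y‖) :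
    Ell q →L[ℝ] StrongDual ℝ EllInfty :=
  LinearMap.mkContinuous₂ (LinearMap.mk₂ ℝ (fun (y : Ell q) (x : EllInfty) => ∑' k, y k * x k)
    (fun y z x => by
      rw [← (summable_abs_mul (hK y).1 x).of_abs.tsum_add (summable_abs_mul (hK z).1 x).of_abs]
      exact tsum_congr fun k => add_mul (y k) (z k) (x k))
    (fun c y x => by
      rw [smul_eq_mul, ← tsum_mul_left]
      exact tsum_congr fun k => mul_assoc c (y k) (x k))
    (fun y x z => by
      rw [← (summable_abs_mul (hK y).1 x).of_abs.tsum_add (summable_abs_mul (hK y).1 z).of_abs]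
      exact tsum_congr fun k => mul_add (y k) (x k) (z k))
    (fun c y x => by
      rw [smul_eq_mul, ← tsum_mul_left]
      exact tsum_congr fun k => mul_left_comm (y k) c (x k))) K fun y x =>
    (abs_tsum_mul_le (hK y).1 x).trans
      (mul_le_mul_of_nonneg_right (hK y).2 (norm_nonneg x))

theorem pairing_indic (q : Exponent) (K : ℝ)
    (hK : ∀ y : Ell q, (Summable fun k => |y k|) ∧ ∑' k, |y k| ≤ K * ‖y‖) (y : Ell q) (j : ℕ) :
    pairing q K hK y (indic {j}) = y j := by
  change ∑' k, y k * ({j} : Set ℕ).indicator 1 k = y j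
  rw [tsum_eq_single j fun k hk => by simp [hk]]
  simp

/-- The dual of `ℓ^∞` is the sum of `ℓ^{q(·)}` and of the functionals vanishing on the unit
vectors, if `ℓ^{q(·)}` embeds into `ℓ^1`. -/
def dualEllInftyEquiv (q : Exponent) (K : ℝ)
    (hK : ∀ y : Ell q, (Summable fun k => |y k|) ∧ ∑' k, |y k| ≤ K * ‖y‖) :
    StrongDual ℝ EllInfty ≃L[ℝ] Ell q × singularDual :=
  ContinuousLinearEquiv.equivOfInverse
    ((coeffs q).prod
      ((ContinuousLinearMap.id ℝ _ - (pairing q K hK).comp (coeffs q)).codRestrict singularDual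
        fun φ k => by
          change φ (indic {k}) - pairing q K hK (coeffs q φ) (indic {k}) = 0
          rw [pairing_indic, coeffs_apply, sub_self]))
    ((pairing q K hK).coprod singularDual.subtypeL)
    (fun φ => by exact add_sub_cancel (pairing q K hK (coeffs q φ)) φ)
    (fun ⟨y, φ⟩ => by
      have h : coeffs q (pairing q K hK y + φ.1) = y := Subtype.ext <| funext fun k => by
        change pairing q K hK y (indic {k}) + φ.1 (indic {k}) = y k
        rw [pairing_indic, φ.2 k, add_zero]
      refine Prod.ext h (Subtype.ext ?_)
      change pairing q K hK y + φ.1 - pairing q K hK (coeffs q (pairing q K hK y + φ.1)) = φ.1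
      rw [h, add_sub_cancel_left])

/-! ### Annihilators and the dual of the germ space -/

theorem eq_sum_indic {x : EllInfty} {s : Finset ℕ} (hx : ∀ k ∉ s, x k = 0) :
    x = ∑ k ∈ s, x k • indic {k} := by
  ext j
  rw [lp.coeFn_sum, Finset.sum_apply]
  change x j = ∑ k ∈ s, x k * ({k} : Set ℕ).indicator 1 j
  by_cases hj : j ∈ s
  · rw [Finset.sum_eq_single_of_mem j hj fun k _ hk => by simp [hk.symm]]
    simp
  · rw [hx j hj, Finset.sum_eq_zero fun k hk => ?_]
    have : j ≠ k := by rintro rfl; exact hj hk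
    simp [this]

/-- The dual of a quotient by a subspace is the annihilator of the subspace. -/
def dualQuotientEquiv {V : Type*} [SeminormedAddCommGroup V] [NormedSpace ℝ V]
    (S : Submodule ℝ V) (Z : Submodule ℝ (StrongDual ℝ V))
    (hZ : ∀ φ, φ ∈ Z ↔ ∀ x ∈ S, φ x = 0) : StrongDual ℝ (V ⧸ S) ≃L[ℝ] Z :=
  ContinuousLinearEquiv.equivOfInverse
    ((ContinuousLinearMap.precomp ℝ S.mkQL).codRestrict Z fun ψ => (hZ _).2 fun x hx => by
      change ψ (S.mkQ x) = 0
      rw [Submodule.mkQ_apply, (Submodule.Quotient.mk_eq_zero S).2 hx, map_zero])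
    (LinearMap.mkContinuous
      { toFun := fun φ : Z => S.liftQL φ.1 ((hZ _).1 φ.2)
        map_add' := fun φ ψ => by
          ext x
          obtain ⟨x, rfl⟩ := S.mkQ_surjective x
          rfl
        map_smul' := fun c φ => by
          ext x
          obtain ⟨x, rfl⟩ := S.mkQ_surjective x
          rfl } 1 fun φ : Z => by
      refine ContinuousLinearMap.opNorm_le_bound _ (by positivity) fun x => ?_
      rw [one_mul]
      refine le_of_forall_pos_le_add fun e he => ?_
      obtain ⟨d, hd, hde⟩ : ∃ d : ℝ, 0 < d ∧ ‖φ‖ * d ≤ e := by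
        refine ⟨e / (‖φ‖ + 1), by positivity, ?_⟩
        rw [mul_div_assoc', div_le_iff₀ (by positivity)]
        nlinarith [norm_nonneg φ]
      -- The quotient norm is an infimum that need not be attained, so a representative is taken
      -- within `d` of it.
      obtain ⟨v, rfl, hv⟩ := Submodule.Quotient.norm_mk_lt x hd
      calc ‖φ.1 v‖ ≤ ‖φ.1‖ * ‖v‖ := φ.1.le_opNorm v
        _ ≤ ‖φ‖ * (‖(Submodule.Quotient.mk v : V ⧸ S)‖ + d) :=
          mul_le_mul_of_nonneg_left hv.le (norm_nonneg _)
        _ ≤ _ := by rw [mul_add]; exact add_le_add_right hde _)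
    (fun ψ => by
      ext x
      obtain ⟨x, rfl⟩ := S.mkQ_surjective x
      rfl)
    fun φ => rfl

/-- A functional on `ℓ^{p(·)} ≅ ℓ^∞` annihilates the closure of `ℓ^{p(·)}_b` if and only if it
vanishes on the unit vectors. -/
theorem comp_mem_singularDual_iff {p : Exponent} (hp : ∀ k, p k ≠ ∞) (h : SummableCondition p)
    (T : Ell p ≃L[ℝ] EllInfty) (hT : ∀ x k, T x k = x k) (φ : StrongDual ℝ (Ell p)) :
    φ.comp (T.symm : EllInfty →L[ℝ] Ell p) ∈ singularDual ↔
      ∀ x ∈ (ellB p).topologicalClosure, φ x = 0 := by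
  constructor
  · intro hφ
    have h1 : ellB p ≤ LinearMap.ker φ.toLinearMap := by
      intro x hx
      have hfin := h.finite_of_pPlus_lt_top hx
      have hs : ∀ k ∉ hfin.toFinset, T x k = 0 := fun k hk => by
        rw [hT]
        simpa using hk
      change φ x = 0
      -- Bounded exponent on the support means finite support, so `x` is a finite combination of
      -- unit vectors, each killed by `φ`.
      rw [← T.symm_apply_apply x, eq_sum_indic hs, map_sum, map_sum]
      refine Finset.sum_eq_zero fun k _ => ?_
      rw [map_smul, map_smul]
      exact (congrArg _ (hφ k)).trans (smul_zero _)
    exact (ellB p).topologicalClosure_minimal h1 φ.isClosed_ker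
  · intro hφ k
    refine hφ _ ((ellB p).le_topologicalClosure ?_)
    have hsub : {j | T.symm (indic {k}) j ≠ 0} ⊆ {k} := fun j hj => by
      by_contra hjk
      refine hj ?_
      rw [← hT, T.apply_symm_apply, indic_apply]
      exact Set.indicator_of_notMem hjk _
    refine (pPlus_mono p hsub).trans_lt ?_
    simpa [pPlus] using (hp k).lt_top

/-- Under the summability condition, the dual of the germ space is `pba`. -/
theorem nonempty_dualGermEquiv {p : Exponent} (hp : ∀ k, p k ≠ ∞) (h : SummableCondition p)
    (T : Ell p ≃L[ℝ] EllInfty) (hT : ∀ x k, T x k = x k) :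
    Nonempty (StrongDual ℝ (Germ p) ≃L[ℝ] Pba) := by
  let D : StrongDual ℝ (Ell p) ≃L[ℝ] StrongDual ℝ EllInfty :=
    T.arrowCongr (ContinuousLinearEquiv.refl ℝ ℝ)
  let Z : Submodule ℝ (StrongDual ℝ (Ell p)) := singularDual.comap D.toLinearMap
  have hZ : ∀ φ, φ ∈ Z ↔ ∀ x ∈ (ellB p).topologicalClosure, φ x = 0 :=
    comp_mem_singularDual_iff hp h T hT
  have hmap : Z.map D.toLinearMap = singularDual :=
    Submodule.map_comap_eq_of_surjective D.surjective _
  exact ⟨(dualQuotientEquiv _ Z hZ).trans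
    ((D.ofSubmodules Z singularDual hmap).trans singularDualEquiv)⟩

end VarSeq

end

theorem theorem3p4 (p : VarSeq.Exponent) (hp : ∀ k, p k ≠ ∞) :
    (VarSeq.SummableCondition p ↔
      ∃ T : VarSeq.Ell p ≃L[ℝ] lp (fun _ : ℕ => ℝ) ∞, ∀ (x : VarSeq.Ell p) (k : ℕ), T x k = x k) ∧
    (VarSeq.SummableCondition p →
      Nonempty (StrongDual ℝ (VarSeq.Ell p) ≃L[ℝ] VarSeq.Ell p.dual × VarSeq.Pba) ∧
      Nonempty (StrongDual ℝ (VarSeq.Germ p) ≃L[ℝ] VarSeq.Pba)) := by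
  refine ⟨⟨fun h => ?_, ?_⟩, fun h => ?_⟩
  · obtain ⟨C, hC, hC1⟩ := h.exists_modular_const_le_one hp
    exact ⟨VarSeq.ellEquivOfConst p C hC hC1, VarSeq.ellEquivOfConst_apply p C hC hC1⟩
  · rintro ⟨T, hT⟩
    refine VarSeq.summableCondition_of_one_mem hp ?_
    -- Since `T` preserves coordinates, the preimage of the constant `1` is that same sequence,
    -- which therefore lies in `ℓ^{p(·)}`.
    convert (T.symm (VarSeq.indic Set.univ)).2 using 1
    funext k
    have := hT (T.symm (VarSeq.indic Set.univ)) k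
    rw [T.apply_symm_apply] at this
    simpa [VarSeq.indic_apply] using this
  · obtain ⟨C, hC, hC1⟩ := h.exists_modular_const_le_one hp
    let T := VarSeq.ellEquivOfConst p C hC hC1
    refine ⟨⟨(T.arrowCongr (ContinuousLinearEquiv.refl ℝ ℝ)).trans
      ((VarSeq.dualEllInftyEquiv p.dual (2 * C)
        (VarSeq.Ell.summable_and_tsum_le hp hC hC1)).trans
        ((ContinuousLinearEquiv.refl ℝ _).prodCongr VarSeq.singularDualEquiv))⟩,
      VarSeq.nonempty_dualGermEquiv hp h _ (VarSeq.ellEquivOfConst_apply p C hC hC1)⟩
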